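/- Let $(X,\langle\cdot,\cdot\rangle)$ be an infinite-dimensional real Hilbert space and let $T:X\to X$ be a non-expansive potential operator, i.e. $\|T(x)-T(y)\|\le\|x-y\|$ for all $x,y\in X$, and $T$ is the Gâteaux derivative of a functional $J:X\to\mathbb R$, that is, $\lim_{t\to 0}\frac{J(x+tv)-J(x)}{t}=\langle T(x),v\rangle$ for all $x,v\in X$. Define $\Phi:X\to X$ by $\Phi(x)=x+T(x)$. If $J$ is sequentially weakly lower semicontinuous (that is, $J(x)\le\liminf_{n\to\infty}J(x_n)$ whenever $x_n\to x$ weakly in $X$), then there exists a closed ball $B$ in $X$, of positive radius, such that $\Phi(B)\cap V\neq\emptyset$ for every convex and dense set $V\subseteq X$. -/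

import Mathlib

open Filter Topology

/-- `T` is the Gateaux derivative of the functional `J` on the Hilbert space `X`, the dual of `X`
being identified with `X` by the inner product: at every point `x` and in every direction `v`,
the derivative at `t = 0` of the map sending `t` to `J (x + t • v)` is `⟪T x, v⟫`. -/
def IsGateauxDerivative {X : Type*} [NormedAddCommGroup X] [InnerProductSpace ℝ X]
    (J : X → ℝ) (T : X → X) : Prop :=
  ∀ x v : X, HasLineDerivAt ℝ J (inner ℝ (T x) v) x v

/-- `J` is sequentially weakly lower semicontinuous: whenever `u n` tends weakly to `x`,
`J x ≤ liminf J (u n)` (as extended reals), i.e. every `c < J x` is eventually below `J (u n)`. -/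
def SeqWeaklyLowerSemicontinuous {X : Type*} [NormedAddCommGroup X] [InnerProductSpace ℝ X]
    (J : X → ℝ) : Prop :=
  ∀ (u : ℕ → X) (x : X),
    Tendsto (fun n => toWeakSpace ℝ X (u n)) atTop (𝓝 (toWeakSpace ℝ X x)) →
      ∀ c : ℝ, c < J x → ∀ᶠ n in atTop, c < J (u n)

/-!
Any closed ball works; the proof takes the closed unit ball `B`. Suppose that a convex dense set `V`
contains no point `x + T x` with `x ∈ B`.

For every `v` the functional `‖x‖² / 2 + J x - ⟪v, x⟫` has gradient `x + T x - v`, which is monotone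
because `T` is non-expansive, so the functional is convex. It attains its minimum on `B`, and if
`v ∈ V` all its minimizers in `B` lie on the unit sphere, since an interior one would be a critical
point. As `‖x‖² / 2` is largest on the sphere, every minimizer of `J - ⟪v, ·⟫` on `B` also
minimizes the convex functional; two of them would have a midpoint that is a minimizer off the
sphere. Hence `J - ⟪v, ·⟫` has at most one minimizer on `B` (`eq_of_isMinOn_closedBall`).

A minimax argument (`le_of_unique_minimizers`) turns this uniqueness into convexity: a weakly lower
semicontinuous function on the weakly compact set `B`, all of whose perturbations by linear
functionals from a convex dense set have at most one minimizer, coincides with its convex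
biconjugate. Consequently `J z ≥ J 0 + ⟪T 0, z⟫` on `B`, and then, for `v ∈ V` close to `T 0`, the
functional `‖x‖² / 2 + J x - ⟪v, x⟫` is larger on the sphere than at `0`, so that its minimizer is
interior after all: a contradiction.

The minimax argument needs topological compactness and semicontinuity, and `X` need not be
separable. That sequential weak lower semicontinuity suffices on bounded sets is
`lowerSemicontinuous_comp_of_seqWeakly`. The weakly compact ball is handled as an abstract compact
space `K` with an injection `e : K → X` such that all functions `⟪w, e ·⟫` are continuous.
-/

universe u

/-! ### Weak topology on bounded sets -/

/-- A bounded sequence whose inner products with each of its own terms tend to zero converges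
weakly to zero: the limit extends to the closed span of the terms, and on its orthogonal complement
the inner products vanish. -/
theorem tendsto_inner_zero_of_pairwise {X : Type*} [NormedAddCommGroup X]
    [InnerProductSpace ℝ X] [CompleteSpace X] {d : ℕ → X} {C : ℝ} (hC : ∀ n, ‖d n‖ ≤ C)
    (hd : ∀ m, Tendsto (fun n => inner ℝ (d n) (d m)) atTop (𝓝 0)) (w : X) :
    Tendsto (fun n => inner ℝ (d n) w) atTop (𝓝 0) := by
  have hspan : ∀ y ∈ Submodule.span ℝ (Set.range d),
      Tendsto (fun n => inner ℝ (d n) y) atTop (𝓝 0) := by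
    intro y hy
    induction hy using Submodule.span_induction with
    | mem y hy => obtain ⟨m, rfl⟩ := hy; exact hd m
    | zero => simp
    | add y z _ _ hy hz => simpa [inner_add_right] using hy.add hz
    | smul a y _ hy => simpa [inner_smul_right] using hy.const_mul a
  let S : Submodule ℝ X := (Submodule.span ℝ (Set.range d)).topologicalClosure
  have : CompleteSpace S := (Submodule.isClosed_topologicalClosure _).completeSpace_coe
  obtain ⟨p, hp, q, hq, rfl⟩ := S.exists_add_mem_mem_orthogonal w
  have hq0 : ∀ n, inner ℝ (d n) q = 0 := fun n =>
    (S.mem_orthogonal q).1 hq _ (Submodule.le_topologicalClosure _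
      (Submodule.subset_span ⟨n, rfl⟩))
  simp only [inner_add_right, hq0, add_zero]
  rw [Metric.tendsto_atTop]
  intro ε hε
  have hC0 : 0 ≤ C := (norm_nonneg _).trans (hC 0)
  obtain ⟨y, hy, hpy⟩ := Metric.mem_closure_iff.1
    (show p ∈ closure (Submodule.span ℝ (Set.range d) : Set X) from hp) (ε / (2 * (C + 1)))
    (by positivity)
  obtain ⟨N, hN⟩ := Metric.tendsto_atTop.1 (hspan y hy) (ε / 2) (by positivity)
  refine ⟨N, fun n hn => ?_⟩
  have h1 := hN n hn
  rw [Real.dist_eq, sub_zero] at h1 ⊢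
  have h2 : |inner ℝ (d n) (p - y)| ≤ ε / 2 := by
    refine (abs_real_inner_le_norm _ _).trans ?_
    rw [dist_eq_norm] at hpy
    calc ‖d n‖ * ‖p - y‖ ≤ (C + 1) * (ε / (2 * (C + 1))) := by
          gcongr
          linarith [hC n]
      _ = ε / 2 := by field_simp
  have h3 : inner ℝ (d n) p = inner ℝ (d n) y + inner ℝ (d n) (p - y) := by
    rw [inner_sub_right]; ring
  rw [h3]
  linarith [abs_add_le (inner ℝ (d n) y) (inner ℝ (d n) (p - y))]

/-- On a bounded set, sequential weak lower semicontinuity implies weak lower semicontinuity. A point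
`x` of the weak closure of a sublevel set is the weak limit of a sequence in it: pick each term so
that its difference with `x` is nearly orthogonal to all the previous differences. -/
theorem lowerSemicontinuous_comp_of_seqWeakly {X : Type*} [NormedAddCommGroup X]
    [InnerProductSpace ℝ X] [CompleteSpace X] {J : X → ℝ} (hJ : SeqWeaklyLowerSemicontinuous J)
    {K : Type*} [TopologicalSpace K] {e : K → X} (he : ∀ w, Continuous fun k => inner ℝ w (e k))
    {C : ℝ} (hC : ∀ k, ‖e k‖ ≤ C) : LowerSemicontinuous (J ∘ e) := by
  rw [lowerSemicontinuous_iff_isClosed_preimage]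
  intro c
  refine isClosed_of_closure_subset fun k hk => ?_
  set x := e k with hx
  -- The second component of a pair measures how nearly orthogonal the differences have to be.
  obtain ⟨f, hfS, hf⟩ := exists_seq_of_forall_finset_exists
    (fun p : K × ℕ => J (e p.1) ≤ c)
    (fun p q : K × ℕ => p.2 < q.2 ∧ |inner ℝ (e p.1 - x) (e q.1 - x)| < 1 / ((q.2 : ℝ) + 1)) (by
      intro s _
      obtain ⟨m, hm⟩ : ∃ m, ∀ p ∈ s, p.2 < m :=
        ⟨s.sup Prod.snd + 1, fun p hp => Nat.lt_succ_of_le (Finset.le_sup (f := Prod.snd) hp)⟩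
      have hU : ∀ᶠ l in 𝓝 k, ∀ p ∈ s, |inner ℝ (e p.1 - x) (e l - x)| < 1 / ((m : ℝ) + 1) := by
        rw [Filter.eventually_all_finset]
        intro p _
        have hc : Continuous fun l => |inner ℝ (e p.1 - x) (e l - x)| := by
          simp only [inner_sub_right (e p.1 - x)]
          exact ((he _).sub continuous_const).abs
        refine hc.continuousAt.eventually_lt continuousAt_const ?_
        simp only [← hx, sub_self, inner_zero_right, abs_zero]
        positivity
      obtain ⟨l, hl, hlS⟩ := (mem_closure_iff_frequently.1 hk).and_eventually hU |>.exists
      exact ⟨(l, m), hl, fun p hp => ⟨hm p hp, hlS p hp⟩⟩)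
  have hmono : StrictMono fun n => (f n).2 :=
    strictMono_nat_of_lt_succ fun n => (hf n (n + 1) n.lt_succ_self).1
  have hlim : ∀ w, Tendsto (fun n => inner ℝ (e (f n).1 - x) w) atTop (𝓝 0) := by
    refine tendsto_inner_zero_of_pairwise (C := C + C)
      (fun n => (norm_sub_le _ _).trans (add_le_add (hC _) (hC _))) fun m => ?_
    refine squeeze_zero_norm' (a := fun n : ℕ => 1 / ((n : ℝ) + 1)) ?_
      tendsto_one_div_add_atTop_nhds_zero_nat
    filter_upwards [eventually_gt_atTop m] with n hn
    rw [real_inner_comm, Real.norm_eq_abs]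
    refine (hf m n hn).2.le.trans ?_
    have : (n : ℝ) ≤ (f n).2 := by exact_mod_cast hmono.le_apply
    gcongr
  have hweak : Tendsto (fun n => toWeakSpace ℝ X (e (f n).1)) atTop (𝓝 (toWeakSpace ℝ X x)) := by
    refine (WeakBilin.tendsto_iff_forall_eval_tendsto (topDualPairing ℝ X).flip
      (fun a b hab => ?_)).2 fun φ => ?_
    · by_contra hne
      have := congrArg (fun g => g (InnerProductSpace.toDual ℝ X (a - b))) hab
      simp only [LinearMap.flip_apply, topDualPairing_apply,
        InnerProductSpace.toDual_apply_apply] at this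
      have h0 : inner ℝ (a - b) (a - b : X) = 0 := by
        have h := inner_sub_right (𝕜 := ℝ) (a - b : X) a b
        rw [h]; exact sub_eq_zero.2 this
      exact hne (sub_eq_zero.1 (inner_self_eq_zero.1 h0))
    · have h := (hlim ((InnerProductSpace.toDual ℝ X).symm φ)).add_const
        (φ x)
      rw [zero_add] at h
      refine h.congr fun n => ?_
      rw [real_inner_comm, InnerProductSpace.toDual_symm_apply, map_sub, sub_add_cancel]
      rfl
  by_contra hlt
  obtain ⟨n, hn⟩ := (hJ _ x hweak c (not_le.1 hlt)).exists
  exact absurd (hfS n) (not_le.2 hn)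

/-- A closed ball of a Hilbert space with its weak topology, as an abstract compact space; it is
realized inside the weak dual, where the Banach-Alaoglu theorem applies. -/
theorem exists_compact_weak_closedBall {X : Type u} [NormedAddCommGroup X]
    [InnerProductSpace ℝ X] [CompleteSpace X] (r : ℝ) :
    ∃ (K : Type u) (_ : TopologicalSpace K) (_ : CompactSpace K) (e : K → X),
      Function.Injective e ∧ (∀ w, Continuous fun k => inner ℝ w (e k)) ∧
        Set.range e = Metric.closedBall 0 r := by
  let S : Set (WeakDual ℝ X) := WeakDual.toStrongDual ⁻¹' Metric.closedBall 0 r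
  have hS : CompactSpace S := isCompact_iff_compactSpace.1 (WeakDual.isCompact_closedBall 0 r)
  let e : S → X := fun φ => (InnerProductSpace.toDual ℝ X).symm (WeakDual.toStrongDual φ.1)
  refine ⟨S, inferInstance, hS, e, ?_, fun w => ?_, ?_⟩
  · exact (InnerProductSpace.toDual ℝ X).symm.injective.comp
      (WeakDual.toStrongDual.injective.comp Subtype.val_injective)
  · have h : Continuous fun φ : S => φ.1 w :=
      (WeakDual.eval_continuous w).comp continuous_subtype_val
    refine h.congr fun φ => ?_
    rw [real_inner_comm, InnerProductSpace.toDual_symm_apply]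
    rfl
  · ext x
    constructor
    · rintro ⟨φ, rfl⟩
      have h : WeakDual.toStrongDual φ.1 ∈ Metric.closedBall 0 r := φ.2
      rw [mem_closedBall_zero_iff] at h ⊢
      rwa [LinearIsometryEquiv.norm_map]
    · intro hx
      rw [mem_closedBall_zero_iff] at hx
      refine ⟨⟨StrongDual.toWeakDual (InnerProductSpace.toDual ℝ X x), ?_⟩, ?_⟩
      · change InnerProductSpace.toDual ℝ X x ∈ Metric.closedBall 0 r
        rwa [mem_closedBall_zero_iff, LinearIsometryEquiv.norm_map]
      · exact (InnerProductSpace.toDual ℝ X).symm_apply_apply x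

theorem lowerSemicontinuous_norm_sq_of_weak {X : Type*} [NormedAddCommGroup X]
    [InnerProductSpace ℝ X] {K : Type*} [TopologicalSpace K] {e : K → X}
    (he : ∀ w, Continuous fun k => inner ℝ w (e k)) :
    LowerSemicontinuous fun k => ‖e k‖ ^ 2 := by
  intro k c hc
  -- The tangent `2 * ⟪e k, ·⟫ - ‖e k‖ ^ 2` lies below `‖·‖ ^ 2` and touches it at `e k`.
  have hcont : Continuous fun l => 2 * inner ℝ (e k) (e l) - ‖e k‖ ^ 2 :=
    ((he _).const_mul 2).sub continuous_const
  have hck : c < 2 * inner ℝ (e k) (e k) - ‖e k‖ ^ 2 := by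
    rw [real_inner_self_eq_norm_sq]; linarith
  filter_upwards [hcont.continuousAt.eventually_const_lt hck] with l hl
  have := norm_sub_sq_real (e k) (e l)
  nlinarith [sq_nonneg ‖e k - e l‖]

/-! ### The minimax argument -/

/-- Minimax inequality. Let `j` be lower semicontinuous on a compact space such that, for each `v` in
a convex dense set, `j - ⟪v, e ·⟫` has at most one minimizer. If all affine minorants of `j` of the
form `⟪v, e ·⟫ + c` are at most `M` at `k₀`, then `j k₀ ≤ M`.

With `h v k = j k + ⟪v, e k₀ - e k⟫`, the hypothesis says `min h v ≤ M` for all `v`. On the convex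
hull of a finite subset of `V` the function `v ↦ min h v` attains its maximum at some `v`, and its
one-sided derivatives there show that the minimizer `k` for `v` satisfies `h w k ≤ M` for all `w` in
the hull. By compactness a single `k` satisfies `h w k ≤ M` for all `w`, which forces `k = k₀`. -/
theorem le_of_unique_minimizers {X : Type*} [NormedAddCommGroup X] [InnerProductSpace ℝ X]
    {K : Type*} [TopologicalSpace K] [CompactSpace K] {e : K → X} (hinj : Function.Injective e)
    (he : ∀ w, Continuous fun k => inner ℝ w (e k)) {j : K → ℝ} (hj : LowerSemicontinuous j)
    {V : Set X} (hV : Convex ℝ V) (hVd : Dense V)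
    (huniq : ∀ v ∈ V, ∀ k k' : K, (∀ l, j k - inner ℝ v (e k) ≤ j l - inner ℝ v (e l)) →
      (∀ l, j k' - inner ℝ v (e k') ≤ j l - inner ℝ v (e l)) → k = k')
    {k₀ : K} {M : ℝ} (hM : ∀ v, ∃ k, j k + inner ℝ v (e k₀ - e k) ≤ M) : j k₀ ≤ M := by
  set h : X → K → ℝ := fun v k => j k + inner ℝ v (e k₀ - e k) with hh
  have hcont : ∀ w, Continuous fun k => inner ℝ w (e k₀ - e k) := fun w => by
    simp only [inner_sub_right]
    exact continuous_const.sub (he w)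
  have hlsc : ∀ v, LowerSemicontinuous (h v) := fun v => hj.add (hcont v).lowerSemicontinuous
  have hex : ∀ v, ∃ k, ∀ l, h v k ≤ h v l := fun v => by
    obtain ⟨k, -, hk⟩ := LowerSemicontinuousOn.exists_isMinOn ⟨k₀, Set.mem_univ k₀⟩ isCompact_univ
      ((hlsc v).lowerSemicontinuousOn _)
    exact ⟨k, fun l => hk (Set.mem_univ l)⟩
  choose κ hκ using hex
  have husc : UpperSemicontinuous fun v => h v (κ v) := by
    intro v c hc
    have hc' : Continuous fun v' => h v' (κ v) := by
      simp only [hh]; fun_prop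
    filter_upwards [hc'.continuousAt.eventually_lt continuousAt_const hc] with v' hv'
    exact (hκ v' _).trans_lt hv'
  -- Where `v ↦ h v (κ v)` is maximal along a segment, its one-sided derivative is nonpositive. The
  -- uniqueness of the minimizer for `v` makes nearby minimizers converge to it.
  have hdir : ∀ v ∈ V, ∀ w, (∀ t : ℝ, 0 < t → t ≤ 1 →
      h (v + t • (w - v)) (κ (v + t • (w - v))) ≤ h v (κ v)) →
      inner ℝ (w - v) (e k₀ - e (κ v)) ≤ 0 := by
    intro v hv w hw
    have hexp : ∀ (t : ℝ) k, h (v + t • (w - v)) k = h v k + t * inner ℝ (w - v) (e k₀ - e k) := by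
      intro t k
      simp only [hh, inner_add_left, real_inner_smul_left]
      ring
    have ht : ∀ n : ℕ, (0 : ℝ) < 1 / ((n : ℝ) + 1) ∧ 1 / ((n : ℝ) + 1) ≤ 1 := fun n =>
      ⟨by positivity, by rw [div_le_one (by positivity)]; linarith [n.cast_nonneg (α := ℝ)]⟩
    set u : ℕ → K := fun n => κ (v + (1 / ((n : ℝ) + 1)) • (w - v)) with hu
    have hle : ∀ n, h v (u n) + 1 / ((n : ℝ) + 1) * inner ℝ (w - v) (e k₀ - e (u n))
        ≤ h v (κ v) := fun n => by
      rw [← hexp]; exact hw _ (ht n).1 (ht n).2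
    have hneg : ∀ n, inner ℝ (w - v) (e k₀ - e (u n)) ≤ 0 := fun n => by
      have h1 := hle n
      have h2 := hκ v (u n)
      by_contra hpos
      have := mul_pos (ht n).1 (not_le.1 hpos)
      linarith
    obtain ⟨b, hb⟩ : ∃ b, ∀ k, b ≤ inner ℝ (w - v) (e k₀ - e k) := by
      obtain ⟨k, -, hk⟩ := isCompact_univ.exists_isMinOn ⟨k₀, Set.mem_univ k₀⟩
        (hcont (w - v)).continuousOn
      exact ⟨_, fun l => hk (Set.mem_univ l)⟩
    obtain ⟨k', -, hk'⟩ := isCompact_univ.ultrafilter_le_nhds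
      ((hyperfilter ℕ).map u) (by simp)
    have hk' : Tendsto u (hyperfilter ℕ) (𝓝 k') := hk'
    have hle' : h v k' ≤ h v (κ v) := by
      refine le_of_forall_pos_le_add fun ε hε => ?_
      refine ((hlsc v).isClosed_preimage (h v (κ v) + ε)).mem_of_tendsto hk'
        (Nat.hyperfilter_le_atTop ?_)
      have hlim : Tendsto (fun n : ℕ => 1 / ((n : ℝ) + 1) * b) atTop (𝓝 (0 * b)) :=
        tendsto_one_div_add_atTop_nhds_zero_nat.mul_const b
      rw [zero_mul] at hlim
      filter_upwards [hlim.eventually_const_lt (neg_lt_zero.2 hε)] with n hn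
      have := mul_le_mul_of_nonneg_left (hb (u n)) (ht n).1.le
      have := hle n
      change h v (u n) ≤ h v (κ v) + ε
      linarith
    have hmin : ∀ k, (∀ l, h v k ≤ h v l) →
        ∀ l, j k - inner ℝ v (e k) ≤ j l - inner ℝ v (e l) := by
      intro k hk l
      have := hk l
      simp only [hh, inner_sub_right] at this
      linarith
    have hkk : κ v = k' := huniq v hv _ _ (hmin _ (hκ v))
      (hmin _ fun l => hle'.trans (hκ v l))
    rw [hkk]
    exact (isClosed_le (hcont (w - v)) continuous_const).mem_of_tendsto hk'
      (Eventually.of_forall hneg)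
  -- A minimizer for the maximal `v` in the convex hull of a finite set.
  have hfin : ∀ s : Finset V, ∃ k, ∀ w ∈ s, h w k ≤ M := by
    intro s
    rcases s.eq_empty_or_nonempty with rfl | hs
    · exact ⟨k₀, by simp⟩
    set P : Set X := convexHull ℝ (Subtype.val '' (s : Set V)) with hP
    have hsub : Subtype.val '' (s : Set V) ⊆ V := by rintro _ ⟨w, -, rfl⟩; exact w.2
    have hPV : P ⊆ V := convexHull_min hsub hV
    have hPc : IsCompact P := (s.finite_toSet.image _).isCompact_convexHull ℝ
    obtain ⟨w₀, hw₀⟩ := hs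
    have hPne : P.Nonempty := ⟨w₀.1, subset_convexHull ℝ _ ⟨w₀, hw₀, rfl⟩⟩
    obtain ⟨v, hvP, hvmax⟩ := UpperSemicontinuousOn.exists_isMaxOn hPne hPc (husc.upperSemicontinuousOn P)
    refine ⟨κ v, fun w hw => ?_⟩
    have hwP : (w : X) ∈ P := subset_convexHull ℝ _ ⟨w, hw, rfl⟩
    have h1 := hdir v (hPV hvP) w fun t ht0 ht1 =>
      hvmax ((convex_convexHull ℝ _).add_smul_sub_mem hvP hwP ⟨ht0.le, ht1⟩)
    obtain ⟨k, hk⟩ := hM v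
    have h2 : h v (κ v) ≤ M := (hκ v k).trans hk
    have h3 : h w (κ v) = h v (κ v) + inner ℝ (w - v) (e k₀ - e (κ v)) := by
      simp only [hh, inner_sub_left]; ring
    linarith
  obtain ⟨k, hk⟩ : (⋂ w : V, {k | h w k ≤ M}).Nonempty := by
    have := isCompact_univ.inter_iInter_nonempty (fun w : V => {k | h w k ≤ M})
      (fun w => (hlsc w).isClosed_preimage M) fun s => by
        obtain ⟨k, hk⟩ := hfin s
        exact ⟨k, Set.mem_univ k, Set.mem_iInter₂.2 hk⟩
    simpa using this
  have hall : ∀ w, h w k ≤ M := by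
    have hcl : IsClosed {w | h w k ≤ M} := isClosed_le (by simp only [hh]; fun_prop)
      continuous_const
    intro w
    exact hcl.closure_subset_iff.2 (fun w hw => Set.mem_iInter.1 hk ⟨w, hw⟩) (hVd w)
  have hek : e k₀ - e k = 0 := by
    by_contra hne
    have hpos : 0 < inner ℝ (e k₀ - e k) (e k₀ - e k) := real_inner_self_pos.2 hne
    -- The scalar makes the left-hand side equal to `M + 1`.
    have := hall (((M - j k + 1) / inner ℝ (e k₀ - e k) (e k₀ - e k)) • (e k₀ - e k))
    simp only [hh, real_inner_smul_left] at this
    rw [div_mul_cancel₀ _ hpos.ne'] at this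
    linarith
  have := hall 0
  rw [hinj (sub_eq_zero.1 hek)]
  simpa [hh] using this

/-! ### Gateaux derivatives and convexity -/

theorem IsGateauxDerivative.half_norm_sq_add {X : Type*} [NormedAddCommGroup X]
    [InnerProductSpace ℝ X] {J : X → ℝ} {T : X → X} (hJT : IsGateauxDerivative J T) (v : X) :
    IsGateauxDerivative (fun x => ‖x‖ ^ 2 / 2 + J x - inner ℝ v x) (fun x => x + T x - v) := by
  intro x w
  have h1 : HasFDerivAt (fun x : X => ‖x‖ ^ 2) (2 • innerSL ℝ x) x :=
    (hasStrictFDerivAt_norm_sq x).hasFDerivAt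
  have h2 : HasFDerivAt (fun x : X => inner ℝ v x) (innerSL ℝ v) x :=
    (innerSL ℝ v).hasFDerivAt
  have h := (((h1.hasLineDerivAt w).div_const 2).add (hJT x w)).sub (h2.hasLineDerivAt w)
  refine HasDerivAt.congr_deriv h ?_
  simp [inner_add_left, inner_sub_left]

theorem IsGateauxDerivative.hasDerivAt_line {X : Type*} [NormedAddCommGroup X]
    [InnerProductSpace ℝ X] {J : X → ℝ} {T : X → X} (hJT : IsGateauxDerivative J T) (x v : X)
    (t : ℝ) : HasDerivAt (fun s : ℝ => J (x + s • v)) (inner ℝ (T (x + t • v)) v) t := by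
  have h : HasDerivAt (fun s : ℝ => J (x + t • v + s • v)) (inner ℝ (T (x + t • v)) v) (t - t) := by
    rw [sub_self]
    exact hJT (x + t • v) v
  refine (h.comp_sub_const t t).congr_of_eventuallyEq (Eventually.of_forall fun s => ?_)
  change J (x + s • v) = J (x + t • v + (s - t) • v)
  rw [add_assoc, ← add_smul, add_sub_cancel]

/-- A functional with monotone gradient is convex. -/
theorem IsGateauxDerivative.convexOn {X : Type*} [NormedAddCommGroup X]
    [InnerProductSpace ℝ X] {J : X → ℝ} {T : X → X} (hJT : IsGateauxDerivative J T)
    (hmono : ∀ x y, 0 ≤ inner ℝ (T x - T y) (x - y)) : ConvexOn ℝ Set.univ J := by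
  refine ⟨convex_univ, fun x _ y _ a b ha hb hab => ?_⟩
  have hline := hJT.hasDerivAt_line x (y - x)
  have hconv : ConvexOn ℝ Set.univ fun s : ℝ => J (x + s • (y - x)) := by
    refine Monotone.convexOn_univ_of_deriv (fun t => (hline t).differentiableAt)
      fun s t hst => ?_
    rw [(hline s).deriv, (hline t).deriv]
    rcases hst.eq_or_lt with rfl | hlt
    · exact le_rfl
    have h := hmono (x + t • (y - x)) (x + s • (y - x))
    rw [add_sub_add_left_eq_sub, ← sub_smul, real_inner_smul_right, inner_sub_left] at h
    exact sub_nonneg.1 (nonneg_of_mul_nonneg_right h (sub_pos.2 hlt))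
  have h := hconv.2 (Set.mem_univ 0) (Set.mem_univ 1) ha hb hab
  have hxy : x + b • (y - x) = a • x + b • y := by
    rw [← eq_sub_iff_add_eq] at hab
    subst hab
    module
  simpa [hxy] using h

theorem IsGateauxDerivative.eq_zero_of_isMinOn {X : Type*} [NormedAddCommGroup X]
    [InnerProductSpace ℝ X] {J : X → ℝ} {T : X → X} (hJT : IsGateauxDerivative J T) {s : Set X}
    {x : X} (hs : s ∈ 𝓝 x) (hx : IsMinOn J s x) : T x = 0 :=
  inner_self_eq_zero.1 (IsLocalExtr.hasLineDerivAt_eq_zero (hx.isLocalMin hs).isExtr (hJT x (T x)))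

/-- Convexity inequalities along the segment from `0` to `z` give the gradient inequality at `0`. -/
theorem IsGateauxDerivative.inner_le_sub {X : Type*} [NormedAddCommGroup X]
    [InnerProductSpace ℝ X] {J : X → ℝ} {T : X → X} (hJT : IsGateauxDerivative J T) {z : X}
    (hz : ∀ t : ℝ, 0 ≤ t → t ≤ 1 → J (t • z) ≤ t * J z + (1 - t) * J 0) :
    inner ℝ (T 0) z ≤ J z - J 0 := by
  have h := (hJT.hasDerivAt_line 0 z 0).tendsto_slope_zero_right
  simp only [zero_add, zero_smul, smul_eq_mul] at h
  refine le_of_tendsto h ?_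
  filter_upwards [Ioc_mem_nhdsGT (zero_lt_one (α := ℝ))] with t ht
  have := hz t ht.1.le ht.2
  rw [inv_mul_le_iff₀ ht.1]
  linarith

/-! ### Minimizers on a ball -/

/-- If `v` is not in the image of the ball under `x ↦ x + T x`, minimizers of the functional with
gradient `x + T x - v` lie on the sphere. -/
theorem norm_eq_of_isMinOn_closedBall {X : Type*} [NormedAddCommGroup X]
    [InnerProductSpace ℝ X] {T : X → X} {J : X → ℝ} (hJT : IsGateauxDerivative J T) {r : ℝ} {v : X}
    (hv : ∀ x ∈ Metric.closedBall 0 r, x + T x ≠ v) {z : X} (hz : z ∈ Metric.closedBall 0 r)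
    (hzmin : IsMinOn (fun x => ‖x‖ ^ 2 / 2 + J x - inner ℝ v x) (Metric.closedBall 0 r) z) :
    ‖z‖ = r := by
  have hzr := mem_closedBall_zero_iff.1 hz
  refine hzr.eq_of_not_lt fun hlt => hv z hz ?_
  exact sub_eq_zero.1 ((hJT.half_norm_sq_add v).eq_zero_of_isMinOn (mem_of_superset
    (Metric.isOpen_ball.mem_nhds (mem_ball_zero_iff.2 hlt)) Metric.ball_subset_closedBall) hzmin)

/-- If `v` is not in the image of the ball under `x ↦ x + T x`, then `J - ⟪v, ·⟫` has at most one
minimizer on the ball. -/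
theorem eq_of_isMinOn_closedBall {X : Type*} [NormedAddCommGroup X]
    [InnerProductSpace ℝ X] {T : X → X} {J : X → ℝ}
    (hT : ∀ x y : X, ‖T x - T y‖ ≤ ‖x - y‖) (hJT : IsGateauxDerivative J T) {r : ℝ} {v : X}
    (hv : ∀ x ∈ Metric.closedBall 0 r, x + T x ≠ v)
    (hex : ∃ z ∈ Metric.closedBall 0 r,
      IsMinOn (fun x => ‖x‖ ^ 2 / 2 + J x - inner ℝ v x) (Metric.closedBall 0 r) z)
    {y y' : X} (hy : y ∈ Metric.closedBall 0 r) (hy' : y' ∈ Metric.closedBall 0 r)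
    (hmin : IsMinOn (fun x => J x - inner ℝ v x) (Metric.closedBall 0 r) y)
    (hmin' : IsMinOn (fun x => J x - inner ℝ v x) (Metric.closedBall 0 r) y') : y = y' := by
  set Ψ : X → ℝ := fun x => ‖x‖ ^ 2 / 2 + J x - inner ℝ v x with hΨ
  have hgrad := hJT.half_norm_sq_add v
  have hsphere : ∀ z ∈ Metric.closedBall (0 : X) r, IsMinOn Ψ (Metric.closedBall 0 r) z →
      ‖z‖ = r := fun z hz hzmin => norm_eq_of_isMinOn_closedBall hJT hv hz hzmin
  have hconv : ConvexOn ℝ Set.univ Ψ := hgrad.convexOn fun x x' => by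
    have h1 : x + T x - v - (x' + T x' - v) = (x - x') + (T x - T x') := by abel
    rw [h1, inner_add_left, real_inner_self_eq_norm_sq]
    have h2 := neg_le_of_abs_le (abs_real_inner_le_norm (T x - T x') (x - x'))
    nlinarith [hT x x', norm_nonneg (x - x')]
  obtain ⟨z, hz, hzmin⟩ := hex
  have hzr := hsphere z hz hzmin
  -- Among points of the ball, `z` maximizes the norm, so minimizers of `J - ⟪v, ·⟫` minimize `Ψ`.
  have hup : ∀ p ∈ Metric.closedBall (0 : X) r,
      IsMinOn (fun x => J x - inner ℝ v x) (Metric.closedBall 0 r) p → Ψ p ≤ Ψ z := by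
    intro p hp hpmin
    have h1 : J p - inner ℝ v p ≤ J z - inner ℝ v z := hpmin hz
    have h2 : ‖p‖ ^ 2 ≤ ‖z‖ ^ 2 := by
      rw [hzr]
      exact pow_le_pow_left₀ (norm_nonneg _) (mem_closedBall_zero_iff.1 hp) 2
    simp only [hΨ]
    linarith
  have hm := hconv.2 (Set.mem_univ y) (Set.mem_univ y')
    (show (0 : ℝ) ≤ 1 / 2 by norm_num) (show (0 : ℝ) ≤ 1 / 2 by norm_num) (by norm_num)
  set m : X := (1 / 2 : ℝ) • y + (1 / 2 : ℝ) • y' with hmdef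
  have hmball : m ∈ Metric.closedBall (0 : X) r :=
    (convex_closedBall 0 r) hy hy' (by norm_num) (by norm_num) (by norm_num)
  have hmz : Ψ m ≤ Ψ z := by
    have h1 := hup y hy hmin
    have h2 := hup y' hy' hmin'
    simp only [smul_eq_mul] at hm
    linarith
  have hmr : ‖m‖ = r := hsphere m hmball fun x hx => hmz.trans (hzmin hx)
  by_contra hne
  have hlt := norm_combo_lt_of_ne (mem_closedBall_zero_iff.1 hy) (mem_closedBall_zero_iff.1 hy')
    hne (a := 1 / 2) (b := 1 / 2) (by norm_num) (by norm_num) (by norm_num)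
  exact hlt.ne hmr

/-! ### The range of the perturbed identity -/

theorem theorem6p1 {X : Type*} [NormedAddCommGroup X] [InnerProductSpace ℝ X] [CompleteSpace X]
    (hX : ¬ FiniteDimensional ℝ X) (T : X → X) (J : X → ℝ)
    (hT : ∀ x y : X, ‖T x - T y‖ ≤ ‖x - y‖)
    (hJT : IsGateauxDerivative J T)
    (hJ : SeqWeaklyLowerSemicontinuous J) :
    ∃ (x₀ : X) (r : ℝ), 0 < r ∧
      ∀ V : Set X, Convex ℝ V → Dense V →
        ((fun x => x + T x) '' Metric.closedBall x₀ r ∩ V).Nonempty := by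
  refine ⟨0, 1, one_pos, fun V hV hVd => ?_⟩
  by_contra hempty
  have hbad : ∀ v ∈ V, ∀ x ∈ Metric.closedBall (0 : X) 1, x + T x ≠ v := by
    rintro v hv x hx rfl
    exact hempty ⟨_, ⟨x, hx, rfl⟩, hv⟩
  obtain ⟨K, _, _, e, hinj, he, hrange⟩ := exists_compact_weak_closedBall (X := X) 1
  have hmem : ∀ k, e k ∈ Metric.closedBall (0 : X) 1 := fun k => hrange ▸ Set.mem_range_self k
  have hsurj : ∀ x ∈ Metric.closedBall (0 : X) 1, ∃ k, e k = x := fun x hx => by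
    rw [← hrange] at hx
    exact hx
  have hlsc : LowerSemicontinuous (J ∘ e) :=
    lowerSemicontinuous_comp_of_seqWeakly hJ he fun k => mem_closedBall_zero_iff.1 (hmem k)
  have hexmin : ∀ v, ∃ z ∈ Metric.closedBall (0 : X) 1,
      IsMinOn (fun x => ‖x‖ ^ 2 / 2 + J x - inner ℝ v x) (Metric.closedBall 0 1) z := by
    intro v
    obtain ⟨k₀, -⟩ := hsurj 0 (by simp)
    have hl : LowerSemicontinuous fun k => 1 / 2 * ‖e k‖ ^ 2 + (J ∘ e) k + -inner ℝ v (e k) :=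
      (((continuous_const_mul (1 / 2 : ℝ)).comp_lowerSemicontinuous
        (lowerSemicontinuous_norm_sq_of_weak he)
        (monotone_mul_left_of_nonneg (by norm_num))).add hlsc).add
        (he v).neg.lowerSemicontinuous
    obtain ⟨k, -, hk⟩ := LowerSemicontinuousOn.exists_isMinOn ⟨k₀, Set.mem_univ k₀⟩ isCompact_univ
      (hl.lowerSemicontinuousOn _)
    refine ⟨e k, hmem k, fun x hx => ?_⟩
    obtain ⟨l, rfl⟩ := hsurj x hx
    have : 1 / 2 * ‖e k‖ ^ 2 + J (e k) + -inner ℝ v (e k) ≤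
      1 / 2 * ‖e l‖ ^ 2 + J (e l) + -inner ℝ v (e l) := hk (Set.mem_univ l)
    change ‖e k‖ ^ 2 / 2 + J (e k) - inner ℝ v (e k) ≤
      ‖e l‖ ^ 2 / 2 + J (e l) - inner ℝ v (e l)
    linarith
  have huniq : ∀ v ∈ V, ∀ k k' : K,
      (∀ l, (J ∘ e) k - inner ℝ v (e k) ≤ (J ∘ e) l - inner ℝ v (e l)) →
      (∀ l, (J ∘ e) k' - inner ℝ v (e k') ≤ (J ∘ e) l - inner ℝ v (e l)) → k = k' := by
    intro v hv k k' hk hk'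
    refine hinj (eq_of_isMinOn_closedBall hT hJT (hbad v hv) (hexmin v) (hmem k) (hmem k') ?_ ?_)
    all_goals
      intro x hx
      obtain ⟨l, rfl⟩ := hsurj x hx
    · exact hk l
    · exact hk' l
  -- The minimax inequality at `t • z`: an affine minorant of `J` on the ball is at most
  -- `t * J z + (1 - t) * J 0` there.
  have hgrad : ∀ z ∈ Metric.closedBall (0 : X) 1, inner ℝ (T 0) z ≤ J z - J 0 := by
    refine fun z hz => hJT.inner_le_sub fun t ht0 ht1 => ?_
    have htz : t • z ∈ Metric.closedBall (0 : X) 1 := by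
      rw [mem_closedBall_zero_iff] at hz ⊢
      rw [norm_smul, Real.norm_of_nonneg ht0]
      exact mul_le_one₀ ht1 (norm_nonneg _) hz
    obtain ⟨kt, hkt⟩ := hsurj _ htz
    obtain ⟨kz, hkz⟩ := hsurj z hz
    obtain ⟨k0, hk0⟩ := hsurj 0 (by simp)
    rw [← hkt]
    refine le_of_unique_minimizers hinj he hlsc hV hVd huniq (k₀ := kt) fun v => ?_
    by_contra! hlt
    have h1 := hlt kz
    have h2 := hlt k0
    simp only [Function.comp_apply, hkt, hkz, hk0, sub_zero, inner_sub_right,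
      real_inner_smul_right] at h1 h2
    have := mul_le_mul_of_nonneg_left h1.le ht0
    have := mul_le_mul_of_nonneg_left h2.le (sub_nonneg.2 ht1)
    rcases ht0.eq_or_lt with rfl | htpos
    · linarith
    · nlinarith [mul_lt_mul_of_pos_left h1 htpos]
  -- For `‖v - T 0‖ < 1 / 2` the functional `‖x‖ ^ 2 / 2 + J x - ⟪v, x⟫` exceeds its value at `0` on
  -- the whole unit sphere.
  obtain ⟨v, hvT, hv⟩ := Metric.dense_iff.1 hVd (T 0) (1 / 2) (by norm_num)
  obtain ⟨z, hz, hzmin⟩ := hexmin v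
  have hz1 : ‖z‖ = 1 := norm_eq_of_isMinOn_closedBall hJT (hbad v hv) hz hzmin
  have h0 : ‖z‖ ^ 2 / 2 + J z - inner ℝ v z ≤ ‖(0 : X)‖ ^ 2 / 2 + J 0 - inner ℝ v 0 :=
    hzmin (by simp)
  simp only [hz1, norm_zero, inner_zero_right] at h0
  have h1 := hgrad z hz
  have h2 := real_inner_le_norm (v - T 0) z
  rw [hz1, mul_one, inner_sub_left] at h2
  rw [mem_ball_iff_norm] at hvT
  linarith
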